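/- Let $L\ge 1$ and let $n_0=d,\ n_1,\dots,n_{L-1},\ n_L=1$ be nonnegative integers. An $L$-layer real-valued feedforward neural network is a map $$\nu=\sigma^{(L)}\circ\rho^{(L)}\circ\cdots\circ\sigma^{(1)}\circ\rho^{(1)}:\mathbb{R}^d\to\mathbb{R},$$ where, for $l=1,\dots,L$: (a), (b) $\rho^{(l)}:\mathbb{R}^{n_{l-1}}\to\mathbb{R}^{n_l}$ is given by $\rho^{(l)}(y)=A^{(l)}y+b^{(l)}$ with an integer weight matrix $A^{(l)}\in\mathbb{Z}^{n_l\times n_{l-1}}$ and a real bias vector $b^{(l)}\in\mathbb{R}^{n_l}$; (c) $\sigma^{(l)}:\mathbb{R}^{n_l}\to\mathbb{R}^{n_l}$ is given coordinatewise by $\sigma^{(l)}(z)=\max\{z,t^{(l)}\}$ with a threshold vector $t^{(l)}\in(\mathbb{R}\cup\{-\infty\})^{n_l}$. A linear region of a map $F:\mathbb{R}^d\to\mathbb{R}^p$ is a maximal nonempty connected open subset of $\mathbb{R}^d$ on which $F$ agrees with an affine map. **Theorem.** Let $\nu:\mathbb{R}^d\to\mathbb{R}$ be such an $L$-layer network with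 $t^{(L)}=-\infty$ and $n_l\ge d$ for all $l=1,\dots,L-1$. Then $\nu$ has at most $$\prod_{l=1}^{L-1}\sum_{i=0}^{d}\binom{n_l}{i}$$ linear regions. In particular, there is a constant $C$ depending only on $d$ and $L$ such that, whenever $d\le n_1,\dots,n_{L-1}\le n$, the number of linear regions of $\nu$ is at most $C\,n^{d(L-1)}$; that is, it is $\mathcal{O}(n^{d(L-1)})$. -/

import Mathlib

/-- The map `x ↦ max {x, t}` on the reals for a threshold `t` in `ℝ ∪ {-∞}`. -/
noncomputable def thresholdMax (t : WithBot ℝ) (x : ℝ) : ℝ := max x (t.unbotD x)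

/-- Taken in `ℝ ∪ {-∞}`, `thresholdMax t x` is the maximum of `x` and `t`. -/
theorem coe_thresholdMax (t : WithBot ℝ) (x : ℝ) :
    ((thresholdMax t x : ℝ) : WithBot ℝ) = max (x : WithBot ℝ) t := by
  induction t with
  | bot => simp [thresholdMax]
  | coe t => simp [thresholdMax]

/-- The parameters of an `L`-layer feedforward neural network with layer dimensions
`w 0` (input), `w 1, …, w (L - 1)` (hidden layers), `w L` (output): integer weight matrices,
real bias vectors, and threshold vectors with entries in `ℝ ∪ {-∞}`.
The index `l : Fin L` stands for the layer number `l + 1`; values of `w` beyond `L` play no role. -/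
structure FeedforwardNetwork (L : ℕ) (w : ℕ → ℕ) where
  weight : (l : Fin L) → Matrix (Fin (w (l + 1))) (Fin (w l)) ℤ
  bias : (l : Fin L) → Fin (w (l + 1)) → ℝ
  threshold : (l : Fin L) → Fin (w (l + 1)) → WithBot ℝ

namespace FeedforwardNetwork

variable {L : ℕ} {w : ℕ → ℕ}

/-- The preactivation `y ↦ A y + b` of a layer. -/
noncomputable def preactivation (N : FeedforwardNetwork L w) (l : Fin L)
    (y : Fin (w l) → ℝ) : Fin (w (l + 1)) → ℝ :=
  ((N.weight l).map (fun a : ℤ => (a : ℝ))).mulVec y + N.bias l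

/-- The activation `z ↦ max {z, t}` of a layer, taken coordinatewise. -/
noncomputable def activation (N : FeedforwardNetwork L w) (l : Fin L)
    (z : Fin (w (l + 1)) → ℝ) : Fin (w (l + 1)) → ℝ :=
  fun i => thresholdMax (N.threshold l i) (z i)

/-- The output of the `l`-th layer as a function of the input of the network; the output of the
`0`-th layer is the input itself. -/
noncomputable def layerOutput (N : FeedforwardNetwork L w) :
    (l : ℕ) → l ≤ L → (Fin (w 0) → ℝ) → Fin (w l) → ℝ
  | 0, _, x => x
  | l + 1, h, x =>
      N.activation ⟨l, h⟩ (N.preactivation ⟨l, h⟩ (N.layerOutput l (Nat.le_of_succ_le h) x))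

/-- The function computed by the network. -/
noncomputable def toMap (N : FeedforwardNetwork L w) : (Fin (w 0) → ℝ) → Fin (w L) → ℝ :=
  N.layerOutput L le_rfl

end FeedforwardNetwork

/-- A linear region of `F : ℝ^d → ℝ^p`: a maximal nonempty connected open subset of the domain on
which `F` agrees with an affine map. -/
def IsLinearRegion {d p : ℕ} (F : (Fin d → ℝ) → Fin p → ℝ) (S : Set (Fin d → ℝ)) : Prop :=
  Maximal (fun U : Set (Fin d → ℝ) => IsOpen U ∧ IsConnected U ∧
    ∃ g : (Fin d → ℝ) →ᵃ[ℝ] (Fin p → ℝ), Set.EqOn F g U) S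

/-- The number of linear regions of `F`, which is `⊤` if there are infinitely many. -/
noncomputable def numLinearRegions {d p : ℕ} (F : (Fin d → ℝ) → Fin p → ℝ) : ℕ∞ :=
  Set.encard {S | IsLinearRegion F S}

/-! Regions are counted through convex covers. On a convex set where the earlier layers are affine,
a layer of `n` threshold units is determined by which of `n` affine functionals are positive. A
shattered subfamily has independent linear parts, hence at most `d` members, so Sauer–Shelah bounds
the patterns (`card_positiveIndices_le`). Each pattern cuts out a convex piece, so the bounds
multiply over hidden layers; the output layer is affine. Finally, distinct regions meet the
interiors of distinct pieces (`HasConvexAffineCover.numLinearRegions_le`). -/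

section AffineCover

open Finset

variable {E V V' : Type*} [AddCommGroup E] [Module ℝ E] [AddCommGroup V] [Module ℝ V]
  [AddCommGroup V'] [Module ℝ V']

/-- The set of indices of the affine functionals `f i` that are positive at `x`. -/
noncomputable def positiveIndices {ι : Type*} [Fintype ι] (f : ι → E →ᵃ[ℝ] ℝ) (x : E) :
    Finset ι := by
  classical exact {i | 0 < f i x}

theorem mem_positiveIndices {ι : Type*} [Fintype ι] {f : ι → E →ᵃ[ℝ] ℝ} {x : E} {i : ι} :
    i ∈ positiveIndices f x ↔ 0 < f i x := by
  simp [positiveIndices]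

/-- Affine functionals whose positivity patterns shatter an index set have linearly independent
linear parts there. -/
theorem linearIndependent_linear_of_forall_subset {ι : Type*} [Fintype ι]
    (f : ι → E →ᵃ[ℝ] ℝ) (h : ∀ A : Set ι, ∃ x, ∀ i, 0 < f i x ↔ i ∈ A) :
    LinearIndependent ℝ (fun i => (f i).linear) := by
  by_contra hli
  obtain ⟨c, hc, j, hj⟩ := Fintype.not_linearIndependent_iff.1 hli
  have hconst : ∀ x y : E, ∑ i, c i * f i x = ∑ i, c i * f i y := by
    intro x y
    have h0 : ∑ i, c i * (f i).linear (x - y) = 0 := by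
      simpa using LinearMap.congr_fun hc (x - y)
    have h1 : ∀ i, (f i).linear (x - y) = f i x - f i y := fun i => by
      simpa using (f i).linearMap_vsub x y
    simp only [h1, mul_sub, sum_sub_distrib] at h0
    linarith
  -- The constant sum `∑ c i * f i` is nonnegative at `x` and nonpositive at `y`, so every term
  -- vanishes at both points; the `j`-th cannot.
  obtain ⟨x, hx⟩ := h {i | 0 < c i}
  obtain ⟨y, hy⟩ := h {i | c i < 0}
  have hx' : ∀ i, 0 ≤ c i * f i x := fun i => by
    by_cases hi : 0 < c i
    · exact mul_nonneg hi.le ((hx i).2 hi).le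
    · exact mul_nonneg_of_nonpos_of_nonpos (not_lt.1 hi)
        (not_lt.1 fun hf => hi ((hx i).1 hf))
  have hy' : ∀ i, c i * f i y ≤ 0 := fun i => by
    by_cases hi : c i < 0
    · exact mul_nonpos_of_nonpos_of_nonneg hi.le ((hy i).2 hi).le
    · exact mul_nonpos_of_nonneg_of_nonpos (not_lt.1 hi)
        (not_lt.1 fun hf => hi ((hy i).1 hf))
  have hxs := sum_nonneg fun i (_ : i ∈ univ) => hx' i
  have hys := sum_nonpos fun i (_ : i ∈ univ) => hy' i
  have hxy := hconst x y
  have hx0 := (sum_eq_zero_iff_of_nonneg fun i _ => hx' i).1 (by linarith) j (mem_univ j)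
  have hy0 := (sum_eq_zero_iff_of_nonpos fun i _ => hy' i).1 (by linarith) j (mem_univ j)
  rcases lt_or_gt_of_ne hj with hj | hj
  · exact (mul_neg_of_neg_of_pos hj ((hy j).2 hj)).ne hy0
  · exact (mul_pos hj ((hx j).2 hj)).ne' hx0

/-- `n` affine functionals on a `d`-dimensional space have at most `∑ i ≤ d, n.choose i`
positivity patterns. -/
theorem card_positiveIndices_le [FiniteDimensional ℝ E] {ι : Type*} [Fintype ι]
    [DecidableEq ι] (f : ι → E →ᵃ[ℝ] ℝ) (𝒜 : Finset (Finset ι))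
    (h𝒜 : ∀ A ∈ 𝒜, ∃ x, positiveIndices f x = A) :
    #𝒜 ≤ ∑ i ∈ range (Module.finrank ℝ E + 1), (Fintype.card ι).choose i := by
  have hdim : 𝒜.vcDim ≤ Module.finrank ℝ E := by
    refine Finset.sup_le fun s hs => ?_
    rw [mem_shatterer] at hs
    have hli : LinearIndependent ℝ (fun i : s => (f i).linear) := by
      refine linearIndependent_linear_of_forall_subset _ fun A => ?_
      classical
      obtain ⟨u, hu, hsu⟩ := hs (t := {i ∈ s | ∃ hi : i ∈ s, (⟨i, hi⟩ : s) ∈ A})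
        (filter_subset _ _)
      obtain ⟨x, rfl⟩ := h𝒜 u hu
      refine ⟨x, fun i => ?_⟩
      have := Finset.ext_iff.1 hsu i
      simpa [mem_positiveIndices] using this
    simpa [Module.finrank_linearMap] using hli.fintype_card_le_finrank
  -- Sauer–Shelah.
  refine (card_le_card_shatterer 𝒜).trans (card_shatterer_le_sum_vcDim.trans ?_)
  refine sum_le_sum_of_subset fun k hk => ?_
  simp only [mem_Iic, Finset.mem_range] at hk ⊢
  omega

theorem convex_setOf_positiveIndices_eq {ι : Type*} [Fintype ι] (f : ι → E →ᵃ[ℝ] ℝ)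
    (A : Finset ι) : Convex ℝ {x | positiveIndices f x = A} := by
  have h : {x | positiveIndices f x = A} = ⋂ i, {x | 0 < f i x ↔ i ∈ A} := by
    ext x
    simp [Finset.ext_iff, mem_positiveIndices]
  rw [h]
  refine convex_iInter fun i => ?_
  by_cases hi : i ∈ A
  · simpa [hi, Set.preimage] using (convex_Ioi (0 : ℝ)).affine_preimage (f i)
  · simpa [hi, Set.preimage] using (convex_Iic (0 : ℝ)).affine_preimage (f i)

/-- `F` is affine on each piece of a cover of `s` by at most `K` convex sets. -/
def HasConvexAffineCover (F : E → V) (s : Set E) (K : ℕ) : Prop :=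
  ∃ 𝒞 : Finset (Set E), #𝒞 ≤ K ∧ (∀ x ∈ s, ∃ C ∈ 𝒞, x ∈ C) ∧
    ∀ C ∈ 𝒞, Convex ℝ C ∧ ∃ g : E →ᵃ[ℝ] V, Set.EqOn F g C

theorem AffineMap.hasConvexAffineCover (g : E →ᵃ[ℝ] V) (s : Set E) :
    HasConvexAffineCover g s 1 :=
  ⟨{Set.univ}, by simp, by simp, fun C hC => by
    obtain rfl := mem_singleton.1 hC
    exact ⟨convex_univ, g, Set.eqOn_refl _ _⟩⟩

namespace HasConvexAffineCover

theorem comp_affineMap {F : E → V} {s : Set E} {K : ℕ} (h : HasConvexAffineCover F s K)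
    (a : V →ᵃ[ℝ] V') : HasConvexAffineCover (fun x => a (F x)) s K := by
  obtain ⟨𝒞, hcard, hcov, h𝒞⟩ := h
  refine ⟨𝒞, hcard, hcov, fun C hC => ?_⟩
  obtain ⟨hconv, g, hg⟩ := h𝒞 C hC
  exact ⟨hconv, a.comp g, fun x hx => by simp [hg hx]⟩

/-- Refining each convex affine piece of `F` into at most `B` pieces for `G`. -/
theorem refine_cover {F : E → V} {G : E → V'} {s : Set E} {K B : ℕ}
    (h : HasConvexAffineCover F s K)
    (hG : ∀ C, Convex ℝ C → ∀ g : E →ᵃ[ℝ] V, Set.EqOn F g C → HasConvexAffineCover G C B) :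
    HasConvexAffineCover G s (K * B) := by
  classical
  obtain ⟨𝒞, hcard, hcov, h𝒞⟩ := h
  have hG' : ∀ C ∈ 𝒞, HasConvexAffineCover G C B := fun C hC => by
    obtain ⟨hconv, g, hg⟩ := h𝒞 C hC
    exact hG C hconv g hg
  choose! 𝒟 hDcard hDcov h𝒟 using hG'
  refine ⟨𝒞.biUnion 𝒟, (card_biUnion_le_card_mul _ _ _ hDcard).trans
    (Nat.mul_le_mul_right _ hcard), fun x hx => ?_, fun D hD => ?_⟩
  · obtain ⟨C, hC, hxC⟩ := hcov x hx
    obtain ⟨D, hD, hxD⟩ := hDcov C hC x hxC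
    exact ⟨D, mem_biUnion.2 ⟨C, hC, hD⟩, hxD⟩
  · obtain ⟨C, hC, hD⟩ := mem_biUnion.1 hD
    exact h𝒟 C hC D hD

end HasConvexAffineCover

theorem exists_thresholdMax_eq_ite (t : WithBot ℝ) (g : E →ᵃ[ℝ] ℝ) :
    ∃ f p q : E →ᵃ[ℝ] ℝ, ∀ x, thresholdMax t (g x) = if 0 < f x then p x else q x := by
  induction t with
  -- Both branches are `g`, so the constant 1 is an arbitrary choice.
  | bot => exact ⟨AffineMap.const ℝ E 1, g, g, fun x => by simp [thresholdMax]⟩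
  | coe t =>
    refine ⟨g - AffineMap.const ℝ E t, g, AffineMap.const ℝ E t, fun x => ?_⟩
    by_cases h : t < g x
    · simp [thresholdMax, h, h.le]
    · simp [thresholdMax, h, not_lt.1 h]

/-- A layer of `n` threshold units splits each convex affine piece into at most
`∑ i ≤ d, n.choose i` pieces. -/
theorem HasConvexAffineCover.thresholdMax [FiniteDimensional ℝ E] {n K : ℕ}
    {F : E → Fin n → ℝ} {s : Set E} (h : HasConvexAffineCover F s K)
    (t : Fin n → WithBot ℝ) :
    HasConvexAffineCover (fun x i => _root_.thresholdMax (t i) (F x i)) s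
      (K * ∑ i ∈ range (Module.finrank ℝ E + 1), n.choose i) := by
  classical
  refine h.refine_cover fun C hC g hg => ?_
  choose f p q hfpq using fun i =>
    exists_thresholdMax_eq_ite (t i) ((AffineMap.proj (k := ℝ) i).comp g)
  set 𝒜 : Finset (Finset (Fin n)) := {A | ∃ x, positiveIndices f x = A} with h𝒜
  refine ⟨𝒜.image fun A => C ∩ {x | positiveIndices f x = A}, ?_, fun x hx => ?_, ?_⟩
  · refine card_image_le.trans ?_
    simpa using card_positiveIndices_le f 𝒜 fun A hA => by simpa [h𝒜] using hA
  · exact ⟨_, mem_image_of_mem _ (by simp [h𝒜] : positiveIndices f x ∈ 𝒜), hx, rfl⟩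
  · simp only [mem_image]
    rintro _ ⟨A, -, rfl⟩
    refine ⟨hC.inter (convex_setOf_positiveIndices_eq f A),
      AffineMap.pi fun i => if i ∈ A then p i else q i, ?_⟩
    rintro x ⟨hxC, rfl⟩
    funext i
    have := hfpq i x
    simp only [AffineMap.comp_apply, AffineMap.proj_apply] at this
    simp only [hg hxC, this]
    by_cases hi : 0 < f i x <;> simp [mem_positiveIndices, hi]

end AffineCover

/-! ### Linear regions versus convex pieces -/

section LinearRegion

open MeasureTheory

/-- Affine maps agreeing on a nonempty open set coincide, so `S ∪ U` is again admissible and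
maximality of `S` absorbs `U`. -/
theorem IsLinearRegion.subset_of_nonempty_inter {d p : ℕ} {F : (Fin d → ℝ) → Fin p → ℝ}
    {S U : Set (Fin d → ℝ)} (hS : IsLinearRegion F S) (hUo : IsOpen U)
    (hUc : IsPreconnected U) (hUa : ∃ g : (Fin d → ℝ) →ᵃ[ℝ] (Fin p → ℝ), Set.EqOn F g U)
    (hSU : (S ∩ U).Nonempty) : U ⊆ S := by
  obtain ⟨hSo, hSc, g, hg⟩ := hS.prop
  obtain ⟨g', hg'⟩ := hUa
  have hgg : g = g' :=
    AffineMap.ext_on ((hSo.inter hUo).affineSpan_eq_top hSU)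
      fun x hx => (hg hx.1).symm.trans (hg' hx.2)
  subst hgg
  obtain ⟨x, hxS, hxU⟩ := hSU
  have hmax := hS.le_of_ge (y := S ∪ U)
    ⟨hSo.union hUo, ⟨⟨x, Or.inl hxS⟩, hSc.isPreconnected.union x hxS hxU hUc⟩, g,
      hg.union hg'⟩ Set.subset_union_left
  exact Set.subset_union_right.trans hmax

/-- Frontiers of convex sets are Haar-null, so finitely many cannot cover a nonempty open set. -/
theorem exists_nonempty_inter_interior {E : Type*} [NormedAddCommGroup E] [NormedSpace ℝ E]
    [FiniteDimensional ℝ E] {S : Set E} (hSo : IsOpen S) (hSn : S.Nonempty)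
    {𝒞 : Finset (Set E)} (hconv : ∀ C ∈ 𝒞, Convex ℝ C) (hcov : ∀ x ∈ S, ∃ C ∈ 𝒞, x ∈ C) :
    ∃ C ∈ 𝒞, (S ∩ interior C).Nonempty := by
  by_contra! hcon
  borelize E
  let μ : Measure E := Measure.addHaar
  have hnull : μ (⋃ C ∈ 𝒞, frontier C) = 0 :=
    (measure_biUnion_null_iff 𝒞.countable_toSet).2 fun C hC => (hconv C hC).addHaar_frontier μ
  refine (hSo.measure_pos μ hSn).ne' (measure_mono_null (fun x hx => ?_) hnull)
  obtain ⟨C, hC, hxC⟩ := hcov x hx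
  refine Set.mem_biUnion hC ⟨subset_closure hxC, fun hxi => ?_⟩
  exact (hcon C hC).subset ⟨hx, hxi⟩

theorem HasConvexAffineCover.numLinearRegions_le {d p K : ℕ} {F : (Fin d → ℝ) → Fin p → ℝ}
    (h : HasConvexAffineCover F Set.univ K) : numLinearRegions F ≤ K := by
  obtain ⟨𝒞, hcard, hcov, h𝒞⟩ := h
  have hex : ∀ S, IsLinearRegion F S → ∃ C ∈ 𝒞, (S ∩ interior C).Nonempty :=
    fun S hS => exists_nonempty_inter_interior hS.prop.1 hS.prop.2.1.nonempty
      (fun C hC => (h𝒞 C hC).1) fun x _ => hcov x trivial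
  choose! c hc hSc using hex
  -- The interior of a shared piece lies in `S` and meets `T`; overlapping regions absorb each
  -- other.
  have hinj : Set.InjOn c {S | IsLinearRegion F S} := by
    intro S (hS : IsLinearRegion F S) T (hT : IsLinearRegion F T) hST
    obtain ⟨hconv, g, hg⟩ := h𝒞 _ (hc S hS)
    have hint : interior (c S) ⊆ S :=
      IsLinearRegion.subset_of_nonempty_inter hS isOpen_interior hconv.interior.isPreconnected
        ⟨g, hg.mono interior_subset⟩ (hSc S hS)
    obtain ⟨x, hxT, hx⟩ := hSc T hT
    have hxS : x ∈ S := hint (hST ▸ hx)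
    obtain ⟨hSo, hSconn, hSa⟩ := hS.prop
    obtain ⟨hTo, hTconn, hTa⟩ := hT.prop
    exact Set.Subset.antisymm
      (IsLinearRegion.subset_of_nonempty_inter hT hSo hSconn.isPreconnected hSa ⟨x, hxT, hxS⟩)
      (IsLinearRegion.subset_of_nonempty_inter hS hTo hTconn.isPreconnected hTa ⟨x, hxS, hxT⟩)
  calc numLinearRegions F ≤ (𝒞 : Set (Set (Fin d → ℝ))).encard :=
        Set.encard_le_encard_of_injOn hc hinj
    _ = (𝒞.card : ℕ∞) := Set.encard_coe_eq_coe_finsetCard 𝒞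
    _ ≤ K := by exact_mod_cast hcard

end LinearRegion

/-! ### Induction over the layers -/

namespace FeedforwardNetwork

variable {L : ℕ} {w : ℕ → ℕ}

theorem exists_affineMap_preactivation (N : FeedforwardNetwork L w) (l : Fin L) :
    ∃ a : (Fin (w l) → ℝ) →ᵃ[ℝ] (Fin (w (l + 1)) → ℝ), ∀ y, N.preactivation l y = a y :=
  ⟨(Matrix.mulVecLin ((N.weight l).map (fun a : ℤ => (a : ℝ)))).toAffineMap +
    AffineMap.const ℝ _ (N.bias l), fun y => by simp [preactivation]⟩

theorem hasConvexAffineCover_layerOutput (N : FeedforwardNetwork L w) (l : ℕ) (h : l ≤ L) :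
    HasConvexAffineCover (N.layerOutput l h) Set.univ
      (∏ k ∈ Finset.Icc 1 l, ∑ i ∈ Finset.range (w 0 + 1), (w k).choose i) := by
  induction l with
  | zero => exact (AffineMap.id ℝ (Fin (w 0) → ℝ)).hasConvexAffineCover Set.univ
  | succ l ih =>
    obtain ⟨a, ha⟩ := N.exists_affineMap_preactivation ⟨l, h⟩
    rw [Finset.prod_Icc_succ_top (by omega)]
    have := ((ih (Nat.le_of_succ_le h)).comp_affineMap a).thresholdMax (N.threshold ⟨l, h⟩)
    simp only [← ha, Module.finrank_fin_fun] at this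
    exact this

theorem hasConvexAffineCover_toMap (N : FeedforwardNetwork L w) (hL : 1 ≤ L)
    (hN : ∀ (l : Fin L) (i : Fin (w (l + 1))), (l : ℕ) + 1 = L → N.threshold l i = ⊥) :
    HasConvexAffineCover N.toMap Set.univ
      (∏ k ∈ Finset.Icc 1 (L - 1), ∑ i ∈ Finset.range (w 0 + 1), (w k).choose i) := by
  obtain ⟨l, rfl⟩ : ∃ l, L = l + 1 := ⟨L - 1, by omega⟩
  obtain ⟨a, ha⟩ := N.exists_affineMap_preactivation ⟨l, l.lt_succ_self⟩
  have := (N.hasConvexAffineCover_layerOutput l l.le_succ).comp_affineMap a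
  have hmap : N.toMap = fun x => a (N.layerOutput l l.le_succ x) := by
    funext x i
    change thresholdMax (N.threshold ⟨l, l.lt_succ_self⟩ i)
      (N.preactivation ⟨l, l.lt_succ_self⟩ (N.layerOutput l l.le_succ x) i) = _
    rw [hN ⟨l, l.lt_succ_self⟩ i rfl, ha]
    simp [thresholdMax]
  rw [hmap]
  exact this

end FeedforwardNetwork

theorem sum_range_choose_le_mul_pow {d m n : ℕ} (hd : d ≤ m) (hm : m ≤ n) :
    ∑ i ∈ Finset.range (d + 1), m.choose i ≤ (d + 1) * n ^ d := by
  have h : ∀ i ∈ Finset.range (d + 1), m.choose i ≤ n ^ d := fun i hi => by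
    have hi : i ≤ d := Nat.lt_succ_iff.1 (Finset.mem_range.1 hi)
    -- Monotonicity of `n ^ i` in `i` fails at `n = 0`, where `d ≤ m ≤ n` forces `0 ^ 0 = 1`.
    rcases Nat.eq_zero_or_pos n with rfl | hn
    · obtain rfl : m = 0 := by omega
      obtain rfl : d = 0 := by omega
      obtain rfl : i = 0 := by omega
      simp
    · exact (Nat.choose_le_pow m i).trans
        ((Nat.pow_le_pow_left hm i).trans (Nat.pow_le_pow_right hn hi))
  simpa using Finset.sum_le_card_nsmul _ _ _ h

theorem mainTheorem4 (d L : ℕ) (hL : 1 ≤ L) :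
    (∀ (w : ℕ → ℕ) (N : FeedforwardNetwork L w),
      w 0 = d → w L = 1 →
      (∀ (l : Fin L) (i : Fin (w (l + 1))), (l : ℕ) + 1 = L → N.threshold l i = ⊥) →
      (∀ l ∈ Finset.Icc 1 (L - 1), d ≤ w l) →
      numLinearRegions N.toMap ≤
        ((∏ l ∈ Finset.Icc 1 (L - 1), ∑ i ∈ Finset.range (d + 1), (w l).choose i : ℕ) : ℕ∞)) ∧
    (∃ C : ℕ, ∀ (n : ℕ) (w : ℕ → ℕ) (N : FeedforwardNetwork L w),
      w 0 = d → w L = 1 →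
      (∀ (l : Fin L) (i : Fin (w (l + 1))), (l : ℕ) + 1 = L → N.threshold l i = ⊥) →
      (∀ l ∈ Finset.Icc 1 (L - 1), d ≤ w l ∧ w l ≤ n) →
      numLinearRegions N.toMap ≤ ((C * n ^ (d * (L - 1)) : ℕ) : ℕ∞)) := by
  have key : ∀ (w : ℕ → ℕ) (N : FeedforwardNetwork L w), w 0 = d →
      (∀ (l : Fin L) (i : Fin (w (l + 1))), (l : ℕ) + 1 = L → N.threshold l i = ⊥) →
      numLinearRegions N.toMap ≤
        ((∏ l ∈ Finset.Icc 1 (L - 1), ∑ i ∈ Finset.range (d + 1), (w l).choose i : ℕ) : ℕ∞) := by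
    rintro w N rfl hN
    exact (N.hasConvexAffineCover_toMap hL hN).numLinearRegions_le
  refine ⟨fun w N h0 _ hN _ => key w N h0 hN, (d + 1) ^ (L - 1),
    fun n w N h0 _ hN hw => (key w N h0 hN).trans ?_⟩
  norm_cast
  calc ∏ l ∈ Finset.Icc 1 (L - 1), ∑ i ∈ Finset.range (d + 1), (w l).choose i
      ≤ ∏ _l ∈ Finset.Icc 1 (L - 1), (d + 1) * n ^ d :=
        Finset.prod_le_prod' fun l hl => sum_range_choose_le_mul_pow (hw l hl).1 (hw l hl).2
    _ = (d + 1) ^ (L - 1) * n ^ (d * (L - 1)) := by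
        simp [mul_pow, pow_mul]
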